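/- Let $\alpha>1$ be an irrational number, let $k\ge 2$ be an integer, and let $f$ be a non-constant polynomial whose coefficients are non-negative integers. For a set $A$ of positive integers let $$\overline{d}(A)=\limsup_{N\to\infty}\frac{|A\cap\{1,\dots,N\}|}{N}$$ denote its upper asymptotic density. If $A$ is a set of positive integers with $\overline{d}(A)>\frac1k-\frac1{k\alpha}$ (so that $A$ is in particular infinite), then $$\Big|\big\{f(a_1)+\cdots+f(a_k): a_i\in A,\ 1\le i\le k\big\}\cap\big\{\lfloor n\alpha\rfloor: n\in\mathbb N\big\}\Big|=\infty ,$$ where $a_1,\dots,a_k$ need not be distinct. -/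

import Mathlib

/-- The upper asymptotic density `limsup |A ∩ {1, …, N}| / N` of a set of natural numbers. -/
noncomputable def upperAsymptoticDensity (A : Set ℕ) : ℝ :=
  Filter.limsup (fun N : ℕ => ((A ∩ Set.Icc 1 N).ncard : ℝ) / (N : ℝ)) Filter.atTop

/-- All sums `f(a₁) + ⋯ + f(aₖ)` with `a₁, …, aₖ ∈ A`, repetitions allowed, as integers. -/
def polySums (f : Polynomial ℕ) (k : ℕ) (A : Set ℕ) : Set ℤ :=
  {m | ∃ a : Fin k → ℕ, (∀ i, a i ∈ A) ∧ m = ∑ i, ((f.eval (a i) : ℕ) : ℤ)}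

/-- The set of all integers `⌊n α⌋` with `n` a natural number. -/
def beattySet (α : ℝ) : Set ℤ :=
  {m | ∃ n : ℕ, m = ⌊(n : ℝ) * α⌋}

open Filter Topology Finset ComplexConjugate Pointwise

/-! Put `θ = 1/α`. A positive integer `m` is some `⌊nα⌋` exactly when `θ m` lies in the arc `(1 - θ,
1)` modulo one. By Weyl, `θ f(n)` is equidistributed modulo one. Cut the circle into `p` equal arcs,
`p` a large prime, and let `J` be the set of arcs met by `θ f(a)` for `a ∈ A`, `a ≥ M`.
Equidistribution turns the density hypothesis into `#J > c p - 2` for some `c > (1 - θ)/k`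
(`eventually_ncard_le_of_arcIndex_mem`). Cauchy-Davenport then gives more than `(1 - θ) p + k + 1`
residues that are sums of `k` elements of `J`, too many for all to miss the target arc, even after
shortening it by the rounding error of `k` integer parts. -/

/-! ### Cesàro means and van der Corput differencing -/

/-- The average of the first `N` terms of a complex sequence. -/
noncomputable def cesaroMean (u : ℕ → ℂ) (N : ℕ) : ℂ := (N : ℂ)⁻¹ * ∑ n ∈ range N, u n

lemma norm_cesaroMean_le {u : ℕ → ℂ} (hu : ∀ n, ‖u n‖ ≤ 1) (N : ℕ) : ‖cesaroMean u N‖ ≤ 1 := by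
  unfold cesaroMean
  rw [norm_mul, norm_inv, Complex.norm_natCast]
  have h : ‖∑ n ∈ range N, u n‖ ≤ N := by
    simpa using norm_sum_le_of_le (range N) (fun n _ => hu n)
  calc (N : ℝ)⁻¹ * ‖∑ n ∈ range N, u n‖ ≤ (N : ℝ)⁻¹ * N := by gcongr
    _ ≤ 1 := inv_mul_le_one

lemma norm_cesaroMean_shift_sub_le {u : ℕ → ℂ} (hu : ∀ n, ‖u n‖ ≤ 1) (d N : ℕ) :
    ‖cesaroMean (fun n => u (n + d)) N - cesaroMean u N‖ ≤ 2 * d / N := by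
  have key : ‖∑ n ∈ range N, u (n + d) - ∑ n ∈ range N, u n‖ ≤ 2 * d := by
    induction d with
    | zero => simp
    | succ d ih =>
      have h : ∑ n ∈ range N, u (n + (d + 1)) - ∑ n ∈ range N, u (n + d) = u (N + d) - u d := by
        rw [← sum_sub_distrib]
        have := sum_range_sub (fun n => u (n + d)) N
        simpa [add_right_comm, add_assoc, add_comm, add_left_comm] using this
      calc _ = ‖(u (N + d) - u d) + (∑ n ∈ range N, u (n + d) - ∑ n ∈ range N, u n)‖ := by
            rw [← h]; congr 1; ring
        _ ≤ (‖u (N + d)‖ + ‖u d‖) + 2 * d :=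
            (norm_add_le _ _).trans (add_le_add (norm_sub_le _ _) ih)
        _ ≤ 2 * (d + 1 : ℕ) := by push_cast; linarith [hu (N + d), hu d]
  unfold cesaroMean
  rw [← mul_sub, norm_mul, norm_inv, Complex.norm_natCast, div_eq_inv_mul]
  gcongr

lemma tendsto_cesaroMean_shift {u : ℕ → ℂ} (hu : ∀ n, ‖u n‖ ≤ 1)
    (h : Tendsto (cesaroMean u) atTop (𝓝 0)) (d : ℕ) :
    Tendsto (cesaroMean fun n => u (n + d)) atTop (𝓝 0) := by
  have h0 : Tendsto (fun N => cesaroMean (fun n => u (n + d)) N - cesaroMean u N) atTop (𝓝 0) :=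
    squeeze_zero_norm (norm_cesaroMean_shift_sub_le hu d)
      (tendsto_const_div_atTop_nhds_zero_nat _)
  simpa using h0.add h

/-- Cauchy-Schwarz, with `‖w n‖ ^ 2` in product form so that a window sum `w` expands into
correlations. -/
lemma norm_cesaroMean_sq_le (w : ℕ → ℂ) (N : ℕ) :
    ‖cesaroMean w N‖ ^ 2 ≤ ‖cesaroMean (fun n => w n * conj (w n)) N‖ := by
  unfold cesaroMean
  have h1 : ∑ n ∈ range N, w n * conj (w n) = ((∑ n ∈ range N, ‖w n‖ ^ 2 : ℝ) : ℂ) := by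
    push_cast
    exact sum_congr rfl fun n _ => Complex.mul_conj' _
  have h2 : ‖∑ n ∈ range N, w n‖ ^ 2 ≤ N * ∑ n ∈ range N, ‖w n‖ ^ 2 := by
    calc _ ≤ (∑ n ∈ range N, ‖w n‖) ^ 2 := by gcongr; exact norm_sum_le _ _
      _ ≤ _ := by simpa using sq_sum_le_card_mul_sum_sq (s := range N) (f := fun n => ‖w n‖)
  rw [h1, norm_mul, norm_mul, norm_inv, Complex.norm_natCast, Complex.norm_real, Real.norm_of_nonneg
    (by positivity), mul_pow]
  rcases Nat.eq_zero_or_pos N with rfl | hN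
  · simp
  · calc _ ≤ ((N : ℝ)⁻¹) ^ 2 * (N * ∑ n ∈ range N, ‖w n‖ ^ 2) := by gcongr
      _ = _ := by field_simp

/-- Van der Corput's difference lemma. -/
theorem tendsto_cesaroMean_of_differences {u : ℕ → ℂ} (hu : ∀ n, ‖u n‖ ≤ 1)
    (h : ∀ d, 0 < d → Tendsto (cesaroMean fun n => u (n + d) * conj (u n)) atTop (𝓝 0)) :
    Tendsto (cesaroMean u) atTop (𝓝 0) := by
  have hprod : ∀ a b n, ‖u (n + a) * conj (u (n + b))‖ ≤ 1 := fun a b n => by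
    rw [norm_mul, RCLike.norm_conj]
    exact mul_le_one₀ (hu _) (norm_nonneg _) (hu _)
  have hlt : ∀ a b, b < a →
      Tendsto (cesaroMean fun n => u (n + a) * conj (u (n + b))) atTop (𝓝 0) := by
    intro a b hab
    have := tendsto_cesaroMean_shift (fun n => hprod (a - b) 0 n) (h (a - b) (by omega)) b
    refine this.congr fun N => ?_
    unfold cesaroMean
    refine congrArg _ (sum_congr rfl fun n _ => ?_)
    simp only [add_zero, show n + b + (a - b) = n + a by omega]
  have hne : ∀ a b, a ≠ b →
      Tendsto (cesaroMean fun n => u (n + a) * conj (u (n + b))) atTop (𝓝 0) := by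
    intro a b hab
    rcases lt_or_gt_of_ne hab with hab | hab
    · have := (Complex.continuous_conj.tendsto 0).comp (hlt b a hab)
      rw [map_zero] at this
      refine this.congr fun N => ?_
      simp [cesaroMean, mul_comm]
    · exact hlt a b hab
  rw [NormedAddGroup.tendsto_nhds_zero]
  intro ε hε
  -- With windows of length `H = K ^ 2`, only the diagonal correlations survive, so the mean of `w`
  -- is at most about `K`, while it is close to `K ^ 2` times the mean of `u`. The contradiction at
  -- the end is `K ^ 2 * ε > 3 * K > K + 2`.
  obtain ⟨K, hK⟩ := exists_nat_gt (3 / ε + 1)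
  have hK1 : (1 : ℝ) < K := by have : 0 < 3 / ε := by positivity
                               linarith
  have hKε : 3 < K * ε := by rw [← div_lt_iff₀ hε]; linarith
  set H := K ^ 2 with hH
  set w : ℕ → ℂ := fun n => ∑ a ∈ range H, u (n + a) with hw
  have hww : ∀ᶠ N in atTop, ‖cesaroMean (fun n => w n * conj (w n)) N‖ < H + 1 := by
    have hlim : Tendsto (fun N => ∑ a ∈ range H, ∑ b ∈ range H,
        if a = b then (1 : ℝ) else ‖cesaroMean (fun n => u (n + a) * conj (u (n + b))) N‖)
        atTop (𝓝 (∑ a ∈ range H, ∑ b ∈ range H, if a = b then (1 : ℝ) else 0)) := by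
      refine tendsto_finsetSum _ fun a _ => tendsto_finsetSum _ fun b _ => ?_
      split_ifs with hab
      · exact tendsto_const_nhds
      · simpa using (hne a b hab).norm
    have hval : (∑ a ∈ range H, ∑ b ∈ range H, if a = b then (1 : ℝ) else 0) = H := by
      rw [sum_congr rfl (fun a ha => by rw [sum_ite_eq, if_pos ha])]
      simp
    rw [hval] at hlim
    filter_upwards [hlim.eventually_lt_const (show (H : ℝ) < H + 1 by linarith)] with N hN
    refine lt_of_le_of_lt ?_ hN
    have hexp : cesaroMean (fun n => w n * conj (w n)) N =
        ∑ a ∈ range H, ∑ b ∈ range H, cesaroMean (fun n => u (n + a) * conj (u (n + b))) N := by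
      have hsq : ∀ n, w n * conj (w n) =
          ∑ a ∈ range H, ∑ b ∈ range H, u (n + a) * conj (u (n + b)) := fun n => by
        simp only [hw, map_sum, sum_mul_sum]
      simp only [cesaroMean, hsq, mul_sum]
      rw [sum_comm]
      exact sum_congr rfl fun a _ => sum_comm
    rw [hexp]
    refine norm_sum_le_of_le _ fun a _ => norm_sum_le_of_le _ fun b _ => ?_
    split_ifs with hab
    · exact norm_cesaroMean_le (hprod a b) N
    · exact le_rfl
  have hdiff : ∀ᶠ N in atTop, ‖cesaroMean w N - H * cesaroMean u N‖ < 1 := by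
    have hlim : Tendsto (fun N : ℕ => ∑ a ∈ range H, 2 * (a : ℝ) / N) atTop (𝓝 0) := by
      simpa using tendsto_finsetSum (range H)
        (fun a _ => tendsto_const_div_atTop_nhds_zero_nat (2 * (a : ℝ)))
    filter_upwards [hlim.eventually_lt_const one_pos] with N hN
    refine lt_of_le_of_lt ?_ hN
    have hexp : cesaroMean w N - H * cesaroMean u N =
        ∑ a ∈ range H, (cesaroMean (fun n => u (n + a)) N - cesaroMean u N) := by
      rw [sum_sub_distrib, sum_const, card_range, nsmul_eq_mul]
      simp only [cesaroMean, hw, ← mul_sum]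
      rw [sum_comm]
    rw [hexp]
    exact norm_sum_le_of_le _ fun a _ => norm_cesaroMean_shift_sub_le hu a N
  filter_upwards [hww, hdiff] with N h1 h2
  have h3 : ‖cesaroMean w N‖ ≤ K + 1 := by
    refine abs_le_of_sq_le_sq' ?_ (by positivity) |>.2
    have := norm_cesaroMean_sq_le w N
    have hHr : (H : ℝ) = (K : ℝ) ^ 2 := by simp [hH]
    nlinarith
  have h4 : (H : ℝ) * ‖cesaroMean u N‖ ≤ K + 2 := by
    have h5 : ‖(H : ℂ) * cesaroMean u N‖ ≤
        ‖cesaroMean w N‖ + ‖cesaroMean w N - H * cesaroMean u N‖ := by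
      have := norm_sub_le (cesaroMean w N) (cesaroMean w N - H * cesaroMean u N)
      rwa [sub_sub_cancel] at this
    rw [norm_mul, Complex.norm_natCast] at h5
    linarith
  have hHr : (H : ℝ) = (K : ℝ) ^ 2 := by simp [hH]
  rw [hHr] at h4
  by_contra! hcon
  have h6 : (K : ℝ) ^ 2 * ε ≤ K ^ 2 * ‖cesaroMean u N‖ := by gcongr
  nlinarith

/-! ### Weyl sums of polynomials -/

lemma tendsto_cesaroMean_pow {z : ℂ} (hz : ‖z‖ = 1) (hz1 : z ≠ 1) :
    Tendsto (cesaroMean fun n => z ^ n) atTop (𝓝 0) := by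
  refine squeeze_zero_norm (a := fun N : ℕ => (2 / ‖z - 1‖) / (N : ℝ)) (fun N => ?_)
    (tendsto_const_div_atTop_nhds_zero_nat _)
  unfold cesaroMean
  rw [geom_sum_eq hz1, norm_mul, norm_inv, Complex.norm_natCast, norm_div, div_eq_inv_mul _ (N : ℝ)]
  gcongr
  calc ‖z ^ N - 1‖ ≤ ‖z ^ N‖ + ‖(1 : ℂ)‖ := norm_sub_le _ _
    _ = 2 := by rw [norm_pow, hz]; norm_num

/-- Weyl's estimate, qualitatively: exponential sums along a polynomial with irrational leading
coefficient are `o(N)`. -/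
theorem tendsto_cesaroMean_fourier_polynomial (m : ℕ) (P : Polynomial ℝ)
    (hdeg : P.natDegree ≤ m + 1) (hirr : Irrational (P.coeff (m + 1))) :
    Tendsto (cesaroMean fun n => fourier 1 ((P.eval (n : ℝ) : ℝ) : UnitAddCircle))
      atTop (𝓝 0) := by
  have hnorm : ∀ x : UnitAddCircle, ‖(fourier 1 x : ℂ)‖ = 1 := fun x => by
    rw [fourier_apply]; exact Circle.norm_coe _
  induction m generalizing P with
  | zero =>
    set c := P.coeff 1 with hc
    have hP : ∀ x : ℝ, P.eval x = c * x + P.coeff 0 := fun x => by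
      conv_lhs => rw [Polynomial.eq_X_add_C_of_natDegree_le_one hdeg]
      simp [hc]
    have hval : ∀ n : ℕ, (fourier 1 ((P.eval (n : ℝ) : ℝ) : UnitAddCircle) : ℂ) =
        fourier 1 ((P.coeff 0 : ℝ) : UnitAddCircle) * fourier 1 ((c : ℝ) : UnitAddCircle) ^ n := by
      intro n
      rw [hP, fourier_coe_apply, fourier_coe_apply, fourier_coe_apply, ← Complex.exp_nat_mul,
        ← Complex.exp_add]
      congr 1
      push_cast
      ring
    have hne : (fourier 1 ((c : ℝ) : UnitAddCircle) : ℂ) ≠ 1 := by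
      intro h
      rw [fourier_coe_apply, Complex.exp_eq_one_iff] at h
      obtain ⟨n, hn⟩ := h
      refine hirr.ne_int n ?_
      have hpi : (2 * Real.pi * Complex.I : ℂ) ≠ 0 := Complex.two_pi_I_ne_zero
      have : (c : ℂ) = n := by
        apply mul_left_cancel₀ hpi
        rw [mul_comm _ (n : ℂ), ← hn]
        simp
      exact_mod_cast this
    have := (tendsto_cesaroMean_pow (hnorm _) hne).const_mul
      (fourier 1 ((P.coeff 0 : ℝ) : UnitAddCircle) : ℂ)
    rw [mul_zero] at this
    refine this.congr fun N => ?_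
    simp only [cesaroMean, hval, ← mul_sum]
    ring
  | succ m ih =>
    refine tendsto_cesaroMean_of_differences (fun n => (hnorm _).le) fun d hd => ?_
    -- `Q(x) = P(x + d) - P(x)` has degree one lower, and its top coefficient is a nonzero integer
    -- multiple of that of `P`, hence still irrational.
    set Q := Polynomial.taylor (d : ℝ) P - P with hQ
    have hcoeff : ∀ i, m + 1 ≤ i → Q.coeff i = (i + 1) * P.coeff (i + 1) * d := by
      intro i hi
      rw [hQ, Polynomial.coeff_sub, Polynomial.taylor_coeff]
      have hlin : (Polynomial.hasseDeriv i P).natDegree ≤ 1 :=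
        (Polynomial.natDegree_hasseDeriv_le P i).trans (by omega)
      rw [Polynomial.eq_X_add_C_of_natDegree_le_one hlin]
      simp [Polynomial.hasseDeriv_coeff, add_comm 1 i]
    have := ih Q ?_ ?_
    · refine this.congr fun N => ?_
      unfold cesaroMean
      refine congrArg _ (sum_congr rfl fun n _ => ?_)
      beta_reduce
      rw [← fourier_neg, fourier_coe_apply, fourier_coe_apply, fourier_coe_apply,
        ← Complex.exp_add, hQ, Polynomial.eval_sub, Polynomial.taylor_eval]
      congr 1
      push_cast
      ring
    · rw [Polynomial.natDegree_le_iff_coeff_eq_zero]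
      intro i hi
      rw [hcoeff i (by omega), Polynomial.coeff_eq_zero_of_natDegree_lt (by omega)]
      simp
    · rw [hcoeff _ le_rfl]
      have h1 := (hirr.natCast_mul (m := m + 1 + 1) (by omega)).mul_natCast (m := d) (by omega)
      simpa using h1

/-! ### Equidistribution on the circle -/

/-- Weyl's criterion. -/
theorem tendsto_cesaroMean_continuousMap {x : ℕ → UnitAddCircle}
    (hx : ∀ h : ℤ, h ≠ 0 → Tendsto (cesaroMean fun n => fourier h (x n)) atTop (𝓝 0))
    (g : C(UnitAddCircle, ℂ)) :
    Tendsto (cesaroMean fun n => g (x n)) atTop (𝓝 (∫ y, g y ∂AddCircle.haarAddCircle)) := by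
  have hint : ∀ g : C(UnitAddCircle, ℂ), MeasureTheory.Integrable g AddCircle.haarAddCircle :=
    fun g => (map_continuous g).integrable_of_hasCompactSupport (HasCompactSupport.of_compactSpace g)
  have hspan : ∀ g ∈ Submodule.span ℂ (Set.range (@fourier 1)),
      Tendsto (cesaroMean fun n => g (x n)) atTop
        (𝓝 (∫ y, g y ∂(AddCircle.haarAddCircle : MeasureTheory.Measure UnitAddCircle))) := by
    intro g hg
    induction hg using Submodule.span_induction with
    | mem g hg =>
      obtain ⟨h, rfl⟩ := hg
      by_cases h0 : h = 0
      · subst h0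
        simp only [fourier_zero, MeasureTheory.integral_const, MeasureTheory.probReal_univ, one_smul]
        refine tendsto_const_nhds.congr' ?_
        filter_upwards [eventually_ne_atTop 0] with N hN
        simp [cesaroMean, hN]
      · have : ∫ y, fourier h y ∂(AddCircle.haarAddCircle : MeasureTheory.Measure UnitAddCircle)
            = 0 := by
          have := fourierCoeff_fourier (T := 1) h
          have h1 := congrFun this 0
          simpa [fourierCoeff, Pi.single_apply, h0, Ne.symm h0] using h1
        rw [this]
        exact hx h h0
    | zero => simp [funext fun N => show cesaroMean (fun _ => 0) N = 0 by simp [cesaroMean]]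
    | add f g _ _ hf hg =>
      simp only [ContinuousMap.add_apply]
      rw [MeasureTheory.integral_add (hint f) (hint g)]
      refine (hf.add hg).congr fun N => ?_
      simp [cesaroMean, sum_add_distrib, mul_add]
    | smul c f _ hf =>
      simp only [ContinuousMap.smul_apply]
      rw [MeasureTheory.integral_smul]
      refine (hf.const_smul c).congr fun N => ?_
      simp only [cesaroMean, smul_eq_mul, ← mul_sum]
      ring
  rw [Metric.tendsto_atTop']
  intro ε hε
  -- Trigonometric polynomials are uniformly dense, so an `ε / 3` argument passes from them to `g`.
  have hg : g ∈ closure (Submodule.span ℂ (Set.range (@fourier 1)) : Set C(UnitAddCircle, ℂ)) := by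
    rw [← Submodule.topologicalClosure_coe, span_fourier_closure_eq_top]
    trivial
  obtain ⟨q, hq, hgq⟩ := Metric.mem_closure_iff.1 hg (ε / 3) (by positivity)
  obtain ⟨N₀, hN₀⟩ := Metric.tendsto_atTop'.1 (hspan q hq) (ε / 3) (by positivity)
  rw [dist_eq_norm] at hgq
  have hpt : ∀ y, ‖g y - q y‖ ≤ ε / 3 := fun y =>
    ((g - q).norm_coe_le_norm y).trans hgq.le
  refine ⟨N₀, fun N hN => ?_⟩
  have h1 : dist (cesaroMean (fun n => g (x n)) N) (cesaroMean (fun n => q (x n)) N) ≤ ε / 3 := by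
    rw [dist_eq_norm]
    unfold cesaroMean
    rw [← mul_sub, ← sum_sub_distrib, norm_mul, norm_inv, Complex.norm_natCast]
    have hN0 : (0 : ℝ) < N := by exact_mod_cast (Nat.zero_le _).trans_lt hN
    rw [inv_mul_le_iff₀ hN0]
    simpa using norm_sum_le_of_le (range N) (fun n _ => hpt (x n))
  have h2 : dist (∫ y, q y ∂(AddCircle.haarAddCircle : MeasureTheory.Measure UnitAddCircle))
      (∫ y, g y ∂AddCircle.haarAddCircle) ≤ ε / 3 := by
    rw [dist_comm, dist_eq_norm, ← MeasureTheory.integral_sub (hint g) (hint q)]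
    have := MeasureTheory.norm_integral_le_of_norm_le_const (μ := AddCircle.haarAddCircle)
      (f := fun y => g y - q y) (Eventually.of_forall hpt)
    simpa using this
  have h3 := hN₀ N hN
  have h4 := dist_triangle4 (cesaroMean (fun n => g (x n)) N) (cesaroMean (fun n => q (x n)) N)
    (∫ y, q y ∂(AddCircle.haarAddCircle : MeasureTheory.Measure UnitAddCircle))
    (∫ y, g y ∂AddCircle.haarAddCircle)
  linarith

/-- A sequence satisfying Weyl's criterion visits an arc of length `2 r` with upper frequency at
most `2 r`. -/
theorem eventually_card_closedBall_le {x : ℕ → UnitAddCircle}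
    (hx : ∀ h : ℤ, h ≠ 0 → Tendsto (cesaroMean fun n => fourier h (x n)) atTop (𝓝 0))
    (c : UnitAddCircle) {r ε : ℝ} (hr : 0 ≤ r) (hε : 0 < ε) :
    ∀ᶠ N : ℕ in atTop, (#{n ∈ range N | ‖x n - c‖ ≤ r} : ℝ) ≤ (2 * r + ε) * N := by
  set δ := ε / 4 with hδ
  have hδ0 : 0 < δ := by positivity
  -- A continuous majorant of the arc: `1` within distance `r` of `c`, `0` beyond `r + δ`. Its
  -- integral is at most `2 * r + ε / 2`.
  set φ : UnitAddCircle → ℝ := fun y => max 0 (1 - max 0 (‖y - c‖ - r) / δ) with hφ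
  have hφc : Continuous φ := by fun_prop
  have hφ0 : ∀ y, 0 ≤ φ y := fun y => le_max_left _ _
  set g : C(UnitAddCircle, ℂ) := ⟨fun y => (φ y : ℂ), by fun_prop⟩ with hg
  have hlim := tendsto_cesaroMean_continuousMap hx g
  have hI : ∫ y, g y ∂AddCircle.haarAddCircle =
      ((∫ y, φ y ∂AddCircle.haarAddCircle : ℝ) : ℂ) := integral_complex_ofReal
  have hle : ∫ y, φ y ∂AddCircle.haarAddCircle ≤ 2 * (r + δ) := by
    have h1 : ∀ y, φ y ≤ (Metric.closedBall c (r + δ)).indicator (fun _ => (1 : ℝ)) y := by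
      intro y
      by_cases hy : y ∈ Metric.closedBall c (r + δ)
      · rw [Set.indicator_of_mem hy]
        refine max_le zero_le_one ?_
        have : 0 ≤ max 0 (‖y - c‖ - r) / δ := by positivity
        linarith
      · rw [Set.indicator_of_notMem hy]
        rw [Metric.mem_closedBall, dist_eq_norm, not_le] at hy
        refine max_le le_rfl ?_
        have : 1 ≤ max 0 (‖y - c‖ - r) / δ := by
          rw [one_le_div hδ0]
          exact le_max_of_le_right (by linarith)
        linarith
    have hvol : (AddCircle.haarAddCircle : MeasureTheory.Measure UnitAddCircle) =
        MeasureTheory.volume := by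
      have := AddCircle.volume_eq_smul_haarAddCircle (T := 1)
      simpa using this.symm
    calc ∫ y, φ y ∂AddCircle.haarAddCircle
        ≤ ∫ y, (Metric.closedBall c (r + δ)).indicator (fun _ => (1 : ℝ)) y
            ∂AddCircle.haarAddCircle := by
          refine MeasureTheory.integral_mono ?_ ?_ h1
          · exact hφc.integrable_of_hasCompactSupport (HasCompactSupport.of_compactSpace φ)
          · exact (MeasureTheory.integrable_const 1).indicator Metric.isClosed_closedBall.measurableSet
      _ = (MeasureTheory.volume (Metric.closedBall c (r + δ))).toReal := by
          rw [MeasureTheory.integral_indicator Metric.isClosed_closedBall.measurableSet, hvol]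
          simp [MeasureTheory.Measure.real]
      _ ≤ 2 * (r + δ) := by
          rw [AddCircle.volume_closedBall]
          refine ENNReal.toReal_le_of_le_ofReal (by positivity) ?_
          exact ENNReal.ofReal_le_ofReal (min_le_right _ _)
  rw [hI] at hlim
  have hre := (Complex.continuous_re.tendsto _).comp hlim
  rw [Complex.ofReal_re] at hre
  filter_upwards [hre.eventually_lt_const (show _ < 2 * r + ε by linarith),
    eventually_gt_atTop 0] with N hN hN0
  have hN0' : (0 : ℝ) < N := by exact_mod_cast hN0
  have hval : (cesaroMean (fun n => g (x n)) N).re = (N : ℝ)⁻¹ * ∑ n ∈ range N, φ (x n) := by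
    have : cesaroMean (fun n => g (x n)) N = (((N : ℝ)⁻¹ * ∑ n ∈ range N, φ (x n) : ℝ) : ℂ) := by
      simp [cesaroMean, hg]
    rw [this, Complex.ofReal_re]
  rw [Function.comp_apply, hval, inv_mul_lt_iff₀ hN0'] at hN
  calc (#{n ∈ range N | ‖x n - c‖ ≤ r} : ℝ) = ∑ n ∈ range N with ‖x n - c‖ ≤ r, (1 : ℝ) := by simp
    _ ≤ ∑ n ∈ range N with ‖x n - c‖ ≤ r, φ (x n) := by
        refine sum_le_sum fun n hn => ?_
        have hn' := (mem_filter.1 hn).2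
        rw [hφ]
        simp [max_eq_left (sub_nonpos.2 hn')]
    _ ≤ ∑ n ∈ range N, φ (x n) :=
        sum_le_sum_of_subset_of_nonneg (filter_subset _ _) fun n _ _ => hφ0 _
    _ ≤ _ := by linarith

/-! ### Sumsets modulo `p` and arcs of the circle -/

/-- The iterated Cauchy-Davenport theorem. -/
lemma ZMod.exists_finset_forall_mem_eq_sum {p : ℕ} [Fact p.Prime] {J : Finset (ZMod p)}
    (hJ : J.Nonempty) (k : ℕ) :
    ∃ S : Finset (ZMod p), (p ≤ #S ∨ (k + 1) * #J ≤ #S + k) ∧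
      ∀ s ∈ S, ∃ a : Fin (k + 1) → ZMod p, (∀ i, a i ∈ J) ∧ s = ∑ i, a i := by
  induction k with
  | zero => exact ⟨J, Or.inr (by simp), fun s hs => ⟨fun _ => s, fun _ => hs, by simp⟩⟩
  | succ k ih =>
    obtain ⟨S, hcard, hS⟩ := ih
    have hJ1 : 1 ≤ #J := hJ.card_pos
    have hSne : S.Nonempty := by
      rw [← card_pos]
      rcases hcard with h | h
      · exact (Fact.out : p.Prime).pos.trans_le h
      · nlinarith
    classical
    refine ⟨J + S, ?_, fun s hs => ?_⟩
    · have hS1 : 1 ≤ #S := hSne.card_pos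
      rcases min_le_iff.1 (ZMod.cauchy_davenport Fact.out hJ hSne) with h | h
      · exact Or.inl h
      · rcases hcard with h' | h'
        · left; omega
        · right
          have : (k + 1 + 1) * #J = (k + 1) * #J + #J := by ring
          omega
    · obtain ⟨j, hj, t, ht, rfl⟩ := Finset.mem_add.1 hs
      obtain ⟨a, ha, rfl⟩ := hS t ht
      refine ⟨Fin.cons j a, fun i => ?_, by simp [Fin.sum_univ_succ]⟩
      refine Fin.cases ?_ (fun i => ?_) i
      · simpa using hj
      · simpa using ha i

/-- The residue modulo `p` of the integer part of `p x`: it records which of the `p` arcs of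
length `1 / p` contains `x` modulo one. -/
noncomputable def arcIndex (p : ℕ) (x : ℝ) : ZMod p := ((⌊(p : ℝ) * x⌋ : ℤ) : ZMod p)

/-- The point `(j + 1/2) / p` is the midpoint of the arc `j`, so each arc lies in a closed ball to
which the frequency bound applies. -/
lemma norm_sub_le_of_arcIndex_eq {p : ℕ} [NeZero p] {x : ℝ} {j : ZMod p} (h : arcIndex p x = j) :
    ‖((x : ℝ) : UnitAddCircle) - (((j.val + 1 / 2) / p : ℝ) : UnitAddCircle)‖ ≤ 1 / (2 * p) := by
  have hp : (0 : ℝ) < p := by exact_mod_cast NeZero.pos p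
  have hdvd : ∃ t : ℤ, ⌊(p : ℝ) * x⌋ = j.val + p * t := by
    have : ((⌊(p : ℝ) * x⌋ : ℤ) : ZMod p) = ((j.val : ℤ) : ZMod p) := by
      rw [← arcIndex, h]; simp
    rw [eq_comm, ZMod.intCast_eq_intCast_iff_dvd_sub] at this
    obtain ⟨t, ht⟩ := this
    exact ⟨t, by linarith⟩
  obtain ⟨t, ht⟩ := hdvd
  have h1 := Int.floor_le ((p : ℝ) * x)
  have h2 := Int.lt_floor_add_one ((p : ℝ) * x)
  rw [ht] at h1 h2
  push_cast at h1 h2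
  set y : ℝ := x - (j.val + 1 / 2) / p - t with hy
  have hxy : ((x : ℝ) : UnitAddCircle) - (((j.val + 1 / 2) / p : ℝ) : UnitAddCircle) =
      (y : UnitAddCircle) := by
    have ht0 : ((t : ℝ) : UnitAddCircle) = 0 := by
      rw [AddCircle.coe_eq_zero_iff]
      exact ⟨t, by simp⟩
    rw [hy, AddCircle.coe_sub, AddCircle.coe_sub, ht0, sub_zero]
  rw [hxy, UnitAddCircle.norm_eq]
  refine (round_le y 0).trans ?_
  have hpy : p * y = p * x - j.val - 1 / 2 - p * t := by rw [hy]; field_simp; ring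
  rw [Int.cast_zero, sub_zero, le_div_iff₀ (by positivity)]
  have : |y| * (2 * p) = |2 * (p * y)| := by
    rw [abs_mul, abs_mul, abs_of_pos hp]; norm_num; ring
  rw [this, abs_le]
  constructor <;> linarith

/-- If the elements of `A` beyond `M` only meet the arcs indexed by `J`, then `A` has upper density
at most about `#J / p`. -/
lemma eventually_ncard_le_of_arcIndex_mem {x : ℕ → ℝ} {p : ℕ} [NeZero p]
    (hx : ∀ h : ℤ, h ≠ 0 → Tendsto (cesaroMean fun n => fourier h ((x n : ℝ) : UnitAddCircle))
      atTop (𝓝 0)) {A : Set ℕ} {M : ℕ} {J : Finset (ZMod p)}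
    (hJ : ∀ a ∈ A, M ≤ a → arcIndex p (x a) ∈ J) :
    ∀ᶠ N : ℕ in atTop, ((A ∩ Set.Icc 1 N).ncard : ℝ) ≤ (#J + 2) / p * N := by
  have hp : (0 : ℝ) < p := by exact_mod_cast NeZero.pos p
  have hJp : (#J : ℝ) ≤ p := by
    have := card_le_univ J
    rw [ZMod.card] at this
    exact_mod_cast this
  have harc : ∀ᶠ N : ℕ in atTop, ∀ j ∈ J,
      (#{n ∈ range (N + 1) | arcIndex p (x n) = j} : ℝ) ≤ (1 / p + 1 / p ^ 2) * (N + 1) := by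
    rw [Filter.eventually_all_finset]
    intro j _
    have h := (tendsto_add_atTop_nat 1).eventually (eventually_card_closedBall_le hx
      (((j.val + 1 / 2) / p : ℝ) : UnitAddCircle) (r := 1 / (2 * p)) (ε := 1 / p ^ 2)
      (by positivity) (by positivity))
    filter_upwards [h] with N hN
    calc (#{n ∈ range (N + 1) | arcIndex p (x n) = j} : ℝ)
        ≤ #{n ∈ range (N + 1) | ‖((x n : ℝ) : UnitAddCircle) -
            (((j.val + 1 / 2) / p : ℝ) : UnitAddCircle)‖ ≤ 1 / (2 * p)} := by
          exact_mod_cast card_le_card (monotone_filter_right _ fun n _ hn =>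
            norm_sub_le_of_arcIndex_eq hn)
      _ ≤ _ := hN
      _ = _ := by push_cast; congr 2; field_simp
  -- The `2` in `#J + 2` has two sources: the errors `1 / p ^ 2` over at most `p` arcs total at most
  -- `1 / p`, and for `N ≥ p * (M + 2)` the elements below `M` together with the shift to `N + 1`
  -- cost at most `N / p`.
  filter_upwards [harc, eventually_ge_atTop ⌈p * (M + 2 : ℝ)⌉₊] with N hN hNM
  have hNM' : (p : ℝ) * (M + 2) ≤ N := (Nat.le_ceil _).trans (by exact_mod_cast hNM)
  have hsub : A ∩ Set.Icc 1 N ⊆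
      ↑(range M ∪ J.biUnion fun j => {n ∈ range (N + 1) | arcIndex p (x n) = j}) := by
    rintro a ⟨haA, -, haN⟩
    simp only [coe_union, Set.mem_union, mem_coe, mem_range, mem_biUnion, mem_filter]
    rcases lt_or_ge a M with h | h
    · exact Or.inl h
    · exact Or.inr ⟨_, hJ a haA h, Nat.lt_succ_of_le haN, rfl⟩
  have h1 : ((A ∩ Set.Icc 1 N).ncard : ℝ) ≤ M + #J * ((1 / p + 1 / p ^ 2) * (N + 1)) := by
    calc ((A ∩ Set.Icc 1 N).ncard : ℝ)
        ≤ #(range M ∪ J.biUnion fun j => {n ∈ range (N + 1) | arcIndex p (x n) = j}) := by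
          rw [← Set.ncard_coe_finset]
          exact_mod_cast Set.ncard_le_ncard hsub (Finset.finite_toSet _)
      _ ≤ #(range M) + ∑ j ∈ J, #{n ∈ range (N + 1) | arcIndex p (x n) = j} := by
          exact_mod_cast (card_union_le _ _).trans (by gcongr; exact card_biUnion_le)
      _ ≤ M + ∑ j ∈ J, (1 / p + 1 / p ^ 2) * (N + 1 : ℝ) := by
          push_cast
          rw [card_range]
          gcongr with j hj
          exact hN j hj
      _ = _ := by rw [sum_const, nsmul_eq_mul]
  refine h1.trans ?_
  have hp1 : (1 : ℝ) ≤ p := by exact_mod_cast NeZero.one_le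
  have h2 : (#J : ℝ) * (1 / p + 1 / p ^ 2) ≤ (#J + 1) / p := by
    have : (#J : ℝ) * (1 / p ^ 2) ≤ p * (1 / p ^ 2) := by gcongr
    calc (#J : ℝ) * (1 / p + 1 / p ^ 2) = (#J : ℝ) / p + (#J : ℝ) * (1 / p ^ 2) := by ring
      _ ≤ (#J : ℝ) / p + (p : ℝ) * (1 / p ^ 2) := by gcongr
      _ = _ := by field_simp
  have h3 : ((#J : ℝ) + 1) / p ≤ 2 := by rw [div_le_iff₀ hp]; linarith
  have h4 : (M + 2 : ℝ) ≤ N / p := by rw [le_div_iff₀ hp]; linarith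
  calc _ = M + #J * (1 / p + 1 / p ^ 2) * (N + 1 : ℝ) := by ring
    _ ≤ M + (#J + 1) / p * (N + 1 : ℝ) := by gcongr
    _ = M + (#J + 1) / p + (#J + 1) / p * N := by ring
    _ ≤ N / p + (#J + 1) / p * N := by linarith
    _ = _ := by ring

/-- The multiples of an integer polynomial by an irrational number satisfy Weyl's criterion. -/
lemma tendsto_cesaroMean_fourier_mul_eval {θ : ℝ} (hθ : Irrational θ) {f : Polynomial ℕ}
    (hf : 0 < f.natDegree) {h : ℤ} (hh : h ≠ 0) :
    Tendsto (cesaroMean fun n => fourier h ((θ * (f.eval n : ℕ) : ℝ) : UnitAddCircle))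
      atTop (𝓝 0) := by
  set P : Polynomial ℝ := Polynomial.C (h * θ) * f.map (Nat.castRingHom ℝ) with hP
  obtain ⟨m, hm⟩ : ∃ m, f.natDegree = m + 1 := ⟨f.natDegree - 1, by omega⟩
  have := tendsto_cesaroMean_fourier_polynomial m P ?_ ?_
  · refine this.congr fun N => ?_
    unfold cesaroMean
    refine congrArg _ (sum_congr rfl fun n _ => ?_)
    beta_reduce
    rw [fourier_coe_apply, fourier_coe_apply, hP, Polynomial.eval_mul, Polynomial.eval_C,
      Polynomial.eval_natCast_map]
    congr 1
    push_cast
    simp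
    ring
  · exact (Polynomial.natDegree_C_mul_le _ _).trans (Polynomial.natDegree_map_le.trans hm.le)
  · rw [hP, Polynomial.coeff_C_mul, Polynomial.coeff_map, ← hm]
    have h0 : f.leadingCoeff ≠ 0 := by
      rw [Polynomial.leadingCoeff_ne_zero]
      rintro rfl
      simp at hf
    exact (hθ.intCast_mul hh).mul_natCast h0

lemma Polynomial.le_eval_of_natDegree_pos {f : Polynomial ℕ} (hf : 0 < f.natDegree) (a : ℕ) :
    a ≤ f.eval a := by
  rw [Polynomial.eval_eq_sum_range]
  have h0 : f.leadingCoeff ≠ 0 := by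
    rw [Polynomial.leadingCoeff_ne_zero]
    rintro rfl
    simp at hf
  calc a ≤ f.coeff f.natDegree * a ^ f.natDegree := by
        refine (Nat.le_self_pow hf.ne' a).trans (Nat.le_mul_of_pos_left _ (Nat.pos_of_ne_zero h0))
    _ ≤ _ := single_le_sum (f := fun i => f.coeff i * a ^ i) (fun _ _ => Nat.zero_le _)
        (self_mem_range_succ _)

/-- If `p x₁, …, p xₖ` have integer parts summing to a suitable residue modulo `p`, then
`x₁ + ⋯ + xₖ` lies in the arc `(1 - θ, 1)` modulo one. -/
lemma exists_int_lt_sum_of_sum_arcIndex {p k : ℕ} [NeZero p] (hk : 0 < k) {θ : ℝ} {x : Fin k → ℝ}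
    {s : ZMod p} (hs : ∑ i, arcIndex p (x i) = s) (hs1 : (1 - θ) * p < s.val) (hs2 : s.val + k ≤ p) :
    ∃ t : ℤ, t - θ < ∑ i, x i ∧ ∑ i, x i < t := by
  have hp : (0 : ℝ) < p := by exact_mod_cast NeZero.pos p
  have : ((∑ i, ⌊(p : ℝ) * x i⌋ : ℤ) : ZMod p) = ((s.val : ℤ) : ZMod p) := by
    rw [Int.cast_sum]
    simpa [arcIndex] using hs
  rw [eq_comm, ZMod.intCast_eq_intCast_iff_dvd_sub] at this
  obtain ⟨t, ht⟩ := this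
  have ht' : ∑ i, (⌊(p : ℝ) * x i⌋ : ℝ) = s.val + p * t := by
    have : ∑ i, ⌊(p : ℝ) * x i⌋ = s.val + p * t := by linarith
    exact_mod_cast this
  have h1 : ∑ i, (⌊(p : ℝ) * x i⌋ : ℝ) ≤ p * ∑ i, x i := by
    rw [mul_sum]
    exact sum_le_sum fun i _ => Int.floor_le _
  have h2 : p * ∑ i, x i < ∑ i, (⌊(p : ℝ) * x i⌋ : ℝ) + k := by
    have : p * ∑ i, x i < ∑ i : Fin k, ((⌊(p : ℝ) * x i⌋ : ℝ) + 1) := by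
      rw [mul_sum]
      exact sum_lt_sum_of_nonempty (univ_nonempty_iff.2 ⟨⟨0, hk⟩⟩)
        fun i _ => Int.lt_floor_add_one _
    simpa [sum_add_distrib] using this
  rw [ht'] at h1 h2
  have hs2' : (s.val : ℝ) + k ≤ p := by exact_mod_cast hs2
  -- The `k` integer parts lose less than `k` in total, so `p * ∑ i, x i` lies in `[s.val + p * t,
  -- s.val + k + p * t)`, which ends by `p * (t + 1)`.
  refine ⟨t + 1, lt_of_mul_lt_mul_left ?_ hp.le, lt_of_mul_lt_mul_left ?_ hp.le⟩ <;>
    push_cast <;> linarith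

/-- Multiplying by `α` gives `m < t * α < m + 1`, so `t` itself is the Beatty index. -/
lemma mem_beattySet_of_lt {α : ℝ} (hα : 0 < α) {m : ℕ} {t : ℤ} (h1 : t - α⁻¹ < α⁻¹ * m)
    (h2 : α⁻¹ * m < t) : (m : ℤ) ∈ beattySet α := by
  have ht : (0 : ℝ) < t := lt_of_le_of_lt (by positivity) h2
  lift t to ℕ using by exact_mod_cast ht.le
  refine ⟨t, ?_⟩
  rw [Int.cast_natCast] at h1 h2
  rw [eq_comm, Int.floor_eq_iff]
  rw [inv_mul_lt_iff₀ hα] at h2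
  have h3 : (t : ℝ) < α⁻¹ * (m + 1) := by linarith
  rw [lt_inv_mul_iff₀ hα] at h3
  push_cast
  constructor <;> linarith

lemma ZMod.card_filter_not_le {p : ℕ} [NeZero p] (k : ℕ) {c : ℝ} (hc : 0 ≤ c) :
    (#{s : ZMod p | ¬(c < s.val ∧ s.val + k ≤ p)} : ℝ) ≤ c + 1 + k := by
  have h : #{s : ZMod p | ¬(c < s.val ∧ s.val + k ≤ p)} ≤
      #(range (⌊c⌋₊ + 1) ∪ Ico (p - k) p) := by
    refine card_le_card_of_injOn ZMod.val (fun s hs => ?_) (ZMod.val_injective p).injOn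
    have hs' : ¬(c < s.val ∧ s.val + k ≤ p) := by simpa using hs
    have hlt := ZMod.val_lt s
    simp only [coe_union, Set.mem_union, mem_coe, mem_range, mem_Ico]
    rw [not_and_or, not_lt, not_le] at hs'
    rcases hs' with h | h
    · exact Or.inl (Nat.lt_succ_of_le (Nat.le_floor h))
    · exact Or.inr ⟨by omega, hlt⟩
  have h2 : #(range (⌊c⌋₊ + 1) ∪ Ico (p - k) p) ≤ ⌊c⌋₊ + 1 + k := by
    refine (card_union_le _ _).trans ?_
    rw [card_range, Nat.card_Ico]
    omega
  have h3 : (#{s : ZMod p | ¬(c < s.val ∧ s.val + k ≤ p)} : ℝ) ≤ (⌊c⌋₊ + 1 + k : ℕ) := by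
    exact_mod_cast h.trans h2
  push_cast at h3
  linarith [Nat.floor_le hc]

/-! ### Combining density, sumset and arc -/

theorem theorem1p1 (α : ℝ) (hα : 1 < α) (hirr : Irrational α) (k : ℕ) (hk : 2 ≤ k)
    (f : Polynomial ℕ) (hf : 0 < f.natDegree)
    (A : Set ℕ) (hA : ∀ a ∈ A, 0 < a)
    (hd : 1 / (k : ℝ) - 1 / ((k : ℝ) * α) < upperAsymptoticDensity A) :
    (polySums f k A ∩ beattySet α).Infinite := by
  have hk0 : (0 : ℝ) < k := by positivity
  set θ := α⁻¹ with hθ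
  have hθ0 : 0 < θ := by positivity
  have hθ1 : θ < 1 := inv_lt_one_of_one_lt₀ hα
  have hd' : (1 - θ) / k < upperAsymptoticDensity A := by
    refine lt_of_eq_of_lt ?_ hd
    rw [hθ]
    field_simp
  obtain ⟨c, hc1, hc2⟩ := exists_between hd'
  rw [div_lt_iff₀ hk0] at hc1
  have hfreq : ∃ᶠ N : ℕ in atTop, c < ((A ∩ Set.Icc 1 N).ncard : ℝ) / N := by
    refine frequently_lt_of_lt_limsup ?_ hc2
    exact IsCoboundedUnder.of_frequently_ge (a := 0) (Frequently.of_forall fun N => by positivity)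
  suffices h : ∀ M : ℕ, ∃ m ∈ polySums f k A ∩ beattySet α, (M : ℤ) ≤ m by
    refine Set.infinite_of_not_bddAbove fun ⟨B, hB⟩ => ?_
    obtain ⟨m, hm, hBm⟩ := h (B.toNat + 1)
    have := hB hm
    omega
  intro M
  -- The first summand makes the density surplus outweigh the losses of order `k` in the sumset
  -- bound. The second settles the case where the sumset is all of `ZMod p`.
  obtain ⟨p, hpge, hp⟩ := Nat.exists_infinite_primes
    (max ⌈4 * k / (c * k - (1 - θ)) + 4 * k / θ⌉₊ 1)
  have : Fact p.Prime := ⟨hp⟩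
  have hp0 : (0 : ℝ) < p := by exact_mod_cast hp.pos
  have hple : 4 * k / (c * k - (1 - θ)) + 4 * k / θ ≤ (p : ℝ) :=
    (Nat.le_ceil _).trans (by exact_mod_cast (le_max_left _ _).trans hpge)
  have hgap : 0 < c * k - (1 - θ) := by linarith
  have hp1 : 4 * k ≤ p * (c * k - (1 - θ)) := by
    rw [← div_le_iff₀ hgap]
    have : 0 ≤ 4 * k / θ := by positivity
    linarith
  have hp2 : 4 * k ≤ p * θ := by
    rw [← div_le_iff₀ hθ0]
    have : 0 ≤ 4 * k / (c * k - (1 - θ)) := by positivity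
    linarith
  classical
  set J : Finset (ZMod p) :=
    {j | ∃ a ∈ A, M ≤ a ∧ arcIndex p (θ * (f.eval a : ℕ)) = j} with hJ
  have hJcard : c * p < #J + 2 := by
    have hev := eventually_ncard_le_of_arcIndex_mem (p := p) (A := A) (M := M) (J := J)
      (fun h hh => tendsto_cesaroMean_fourier_mul_eval hirr.inv hf hh)
      (fun a ha hMa => by simpa [hJ] using ⟨a, ha, hMa, rfl⟩)
    -- The limsup gives only infinitely many `N`, which suffices since the upper bound holds for all
    -- large `N`.
    obtain ⟨N, h1, h2, h3⟩ := (hfreq.and_eventually (hev.and (eventually_gt_atTop 0))).exists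
    have hN : (0 : ℝ) < N := by exact_mod_cast h3
    rw [lt_div_iff₀ hN] at h1
    have h4 := lt_of_mul_lt_mul_right (h1.trans_le h2) hN.le
    rwa [lt_div_iff₀ hp0] at h4
  have hk2 : (2 : ℝ) ≤ k := by exact_mod_cast hk
  have hJk : (1 - θ) * p + 2 * k < k * #J := by nlinarith
  have hJne : J.Nonempty := by
    rw [nonempty_iff_ne_empty]
    intro h0
    rw [h0] at hJk
    have : 0 ≤ (1 - θ) * p := mul_nonneg (by linarith) hp0.le
    simp at hJk
    linarith
  obtain ⟨S, hScard, hS⟩ := ZMod.exists_finset_forall_mem_eq_sum hJne (k - 1)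
  rw [Nat.sub_add_cancel (by omega : 1 ≤ k)] at hScard hS
  have hbad := ZMod.card_filter_not_le (p := p) k (c := (1 - θ) * p)
    (mul_nonneg (by linarith) hp0.le)
  have hScard' : (1 - θ) * p + 1 + k < (#S : ℝ) := by
    rcases hScard with h | h
    · have : (p : ℝ) ≤ #S := by exact_mod_cast h
      nlinarith
    · have h' : k * #J + 1 ≤ #S + k := by omega
      have : (k : ℝ) * #J + 1 ≤ #S + k := by exact_mod_cast h'
      linarith
  -- Pigeonhole: `S` has more elements than there are residues violating the condition.
  obtain ⟨s, hsS, hs⟩ : ∃ s ∈ S, (1 - θ) * p < s.val ∧ s.val + k ≤ p := by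
    by_contra! hcon
    have : #S ≤ #{s : ZMod p | ¬((1 - θ) * p < s.val ∧ s.val + k ≤ p)} :=
      card_le_card fun s hs => by simpa using hcon s hs
    have : (#S : ℝ) ≤ #{s : ZMod p | ¬((1 - θ) * p < s.val ∧ s.val + k ≤ p)} := by
      exact_mod_cast this
    linarith
  obtain ⟨j, hjJ, hsj⟩ := hS s hsS
  have hex : ∀ i, ∃ a ∈ A, M ≤ a ∧ arcIndex p (θ * (f.eval a : ℕ)) = j i := fun i => by
    simpa [hJ] using hjJ i
  choose a haA haM haj using hex
  obtain ⟨t, ht1, ht2⟩ := exists_int_lt_sum_of_sum_arcIndex (θ := θ)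
    (x := fun i => θ * (f.eval (a i) : ℕ)) (s := s) (by omega)
    (by rw [hsj]; exact sum_congr rfl fun i _ => haj i) hs.1 hs.2
  have hsum : ∑ i, θ * ((f.eval (a i) : ℕ) : ℝ) = θ * (∑ i, f.eval (a i) : ℕ) := by
    push_cast
    rw [mul_sum]
  rw [hsum] at ht1 ht2
  refine ⟨((∑ i, f.eval (a i) : ℕ) : ℤ), ⟨⟨a, haA, by push_cast; rfl⟩,
    mem_beattySet_of_lt (by linarith) ht1 ht2⟩, ?_⟩
  have h0 : M ≤ ∑ i, f.eval (a i) := by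
    let i₀ : Fin k := ⟨0, by omega⟩
    calc M ≤ f.eval (a i₀) :=
          (haM i₀).trans (Polynomial.le_eval_of_natDegree_pos hf (a i₀))
      _ ≤ _ := single_le_sum (f := fun i => f.eval (a i)) (fun _ _ => Nat.zero_le _) (mem_univ i₀)
  exact_mod_cast h0
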